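/- For a topological space $X$ let $C_k(X)$ be the space of continuous functions $X\to\mathbb R$ with the compact-open topology. A topological space is Suslin if it is the image of a Polish space under a continuous map. $X$ is Ascoli if the map $X\to C_k(C_k(X))$, $x\mapsto\delta_x$, where $\delta_x(f)=f(x)$, is continuous. A uniformity on a set $X$ is $\omega^\omega$-based if it has a base $(U_\alpha)_{\alpha\in\omega^\omega}$ such that $U_\beta\subseteq U_\alpha$ whenever $\alpha\le\beta$, where $\alpha\le\beta$ means $\alpha(n)\le\beta(n)$ for all $n\in\omega$. A uniformity on a topological space $X$ is $\mathbb R$-universal if it generates the topology of $X$ and every continuous function $X\to\mathbb R$ is uniformly continuous with respect to it. Theorem 1.5. Let $X$ be a Tychonoff space. (1) If $X$ is separable and has an $\mathbb R$-universal $\omega^\omega$-based uniformity, then $C_k(X)$ is Suslin. (2) If $X$ is Ascoli and $C_k(X)$ is Suslin, then $X$ is separable and has an $\mathbb R$-universal $\omega^\omega$-based uniformity. -/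

import Mathlib

open Filter Topology Uniformity

universe u v

/-- A topological space is Suslin if it is the image of a Polish space under a continuous map.
Every Polish space is homeomorphic to one in `Type`, so nothing is lost by letting `P` range over
`Type` only; see `isSuslin_of_polishSpace`. -/
def IsSuslin (Y : Type u) [TopologicalSpace Y] : Prop :=
  ∃ (P : Type) (_ : TopologicalSpace P) (_ : PolishSpace P) (f : P → Y),
    Continuous f ∧ Function.Surjective f

/-- A continuous image of a Polish space living in an arbitrary universe is Suslin. -/
theorem isSuslin_of_polishSpace {Y : Type u} [TopologicalSpace Y] {P : Type v}
    [TopologicalSpace P] [PolishSpace P] {f : P → Y} (hf : Continuous f)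
    (hs : Function.Surjective f) : IsSuslin Y := by
  have h := MeasureTheory.analyticSet_range_of_polishSpace hf
  rw [hs.range_eq, MeasureTheory.analyticSet_iff_exists_polishSpace_range] at h
  obtain ⟨Q, tQ, pQ, g, hg, hr⟩ := h
  exact ⟨Q, tQ, pQ, g, hg, Set.range_eq_univ.mp hr⟩

/-- The Dirac functional `δ_x : C_k(X) → ℝ`, `f ↦ f x`, as a point of `C_k(C_k(X))`. Here and below
`C(X, ℝ)` carries Mathlib's topology on it, which is the compact-open one. -/
def diracFunctional {X : Type u} [TopologicalSpace X] (x : X) : C(C(X, ℝ), ℝ) where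
  toFun f := f x
  continuous_toFun := continuous_eval_const x

/-- `X` is Ascoli if the canonical map `X → C_k(C_k(X))`, `x ↦ δ_x`, is continuous. -/
def IsAscoli (X : Type u) [TopologicalSpace X] : Prop :=
  Continuous (diracFunctional : X → C(C(X, ℝ), ℝ))

/-- A uniformity is `ω^ω`-based if it has a base `(U_α)`, indexed by `α ∈ ω^ω`, with `U_β ⊆ U_α`
whenever `α ≤ β` in the coordinatewise order. -/
def IsOmegaOmegaBased {X : Type u} (𝒰 : UniformSpace X) : Prop :=
  ∃ U : (ℕ → ℕ) → Set (X × X), 𝓤[𝒰].HasBasis (fun _ => True) U ∧ ∀ α β, α ≤ β → U β ⊆ U α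

/-- A uniformity on a topological space `X` is `ℝ`-universal if it generates the topology of `X`
and every continuous function `X → ℝ` is uniformly continuous with respect to it. -/
def IsRealUniversal {X : Type u} [t : TopologicalSpace X] (𝒰 : UniformSpace X) : Prop :=
  𝒰.toTopologicalSpace = t ∧
    ∀ f : X → ℝ, Continuous[t, _] f → @UniformContinuous X ℝ 𝒰 _ f

/-! For (1), code `f` by a modulus of continuity and its values on a countable dense set. The codes
form a subset of a Polish space, and decoding is continuous: moduli along a convergent sequence have
a common bound, so pointwise convergence on the dense set becomes locally uniform. Decoding then
extends to the closure of the codes. For (2), let `F` map `ω^ω` continuously onto `C_k(X)`. Each box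
`{β | β ≤ α}` is compact, so the Ascoli property makes its image equicontinuous. Uniform closeness
over these images gives the uniformity. -/

section FunctionSpaceSuslin

variable {X : Type u}

/-- Real functions whose variation on the set `U (A n)` is at most `1 / (n + 1)`, for every `n`. -/
def HasModulus (U : (ℕ → ℕ) → Set (X × X)) (A : ℕ → ℕ → ℕ) (f : X → ℝ) : Prop :=
  ∀ n x y, (x, y) ∈ U (A n) → dist (f x) (f y) ≤ 1 / ((n : ℝ) + 1)

theorem HasModulus.mono {U : (ℕ → ℕ) → Set (X × X)} (hU : ∀ α β, α ≤ β → U β ⊆ U α)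
    {A B : ℕ → ℕ → ℕ} (hAB : A ≤ B) {f : X → ℝ} (hf : HasModulus U A f) : HasModulus U B f :=
  fun n x y h => hf n x y (hU _ _ (hAB n) h)

theorem HasModulus.uniformContinuous [UniformSpace X] {U : (ℕ → ℕ) → Set (X × X)}
    (hU : ∀ α, U α ∈ 𝓤 X) {A : ℕ → ℕ → ℕ} {f : X → ℝ} (hf : HasModulus U A f) :
    UniformContinuous f := by
  refine Metric.uniformity_basis_dist.tendsto_right_iff.2 fun ε hε => ?_
  obtain ⟨n, hn⟩ := exists_nat_one_div_lt hε
  filter_upwards [hU (A n)] with p hp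
  exact (hf n p.1 p.2 hp).trans_lt hn

theorem exists_hasModulus [UniformSpace X] {U : (ℕ → ℕ) → Set (X × X)}
    (hU : (𝓤 X).HasBasis (fun _ => True) U) {f : X → ℝ} (hf : UniformContinuous f) :
    ∃ A, HasModulus U A f := by
  have h : ∀ n : ℕ, ∃ α, ∀ x y, (x, y) ∈ U α → dist (f x) (f y) ≤ 1 / ((n : ℝ) + 1) := by
    intro n
    obtain ⟨α, -, hα⟩ := (hU.tendsto_iff Metric.uniformity_basis_dist).1 hf
      (1 / ((n : ℝ) + 1)) (by positivity)
    exact ⟨α, fun x y hxy => (hα (x, y) hxy).le⟩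
  choose A hA using h
  exact ⟨A, hA⟩

/-- A sequence with a common modulus that converges pointwise on a dense set converges in the
compact-open topology. -/
theorem exists_tendsto_of_hasModulus [UniformSpace X] {U : (ℕ → ℕ) → Set (X × X)}
    (hU : ∀ α, U α ∈ 𝓤 X) {D : Set X} (hD : Dense D) {B : ℕ → ℕ → ℕ} {F : ℕ → C(X, ℝ)}
    (hF : ∀ k, HasModulus U B (F k)) {h : D → ℝ}
    (hlim : ∀ d : D, Tendsto (fun k => F k d) atTop (𝓝 (h d))) :
    ∃ f : C(X, ℝ), (∀ d : D, f d = h d) ∧ Tendsto F atTop (𝓝 f) := by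
  have hcauchy : ∀ x, CauchySeq fun k => F k x := by
    intro x
    refine Metric.cauchySeq_iff'.2 fun ε hε => ?_
    obtain ⟨n, hn⟩ := exists_nat_one_div_lt (show 0 < ε / 3 by positivity)
    obtain ⟨d, hdx, hdD⟩ := mem_closure_iff_nhds.1 (hD x) _ (UniformSpace.ball_mem_nhds x (hU (B n)))
    obtain ⟨N, hN⟩ := Metric.cauchySeq_iff'.1 (hlim ⟨d, hdD⟩).cauchySeq (ε / 3) (by positivity)
    refine ⟨N, fun k hk => ?_⟩
    have h1 := hF k n x d hdx
    have h2 := hF N n x d hdx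
    have h3 := hN k hk
    rw [dist_comm] at h2
    have h4 := dist_triangle4 (F k x) (F k d) (F N d) (F N x)
    simp only at h3
    linarith
  choose g hg using fun x => cauchySeq_tendsto_of_complete (hcauchy x)
  have hgm : HasModulus U B g := fun n x y hxy =>
    le_of_tendsto ((hg x).dist (hg y)) (Eventually.of_forall fun k => hF k n x y hxy)
  refine ⟨⟨g, (hgm.uniformContinuous hU).continuous⟩,
    fun d => tendsto_nhds_unique (hg d) (hlim d), ?_⟩
  refine ContinuousMap.tendsto_of_tendstoLocallyUniformly
    (Metric.tendstoLocallyUniformly_iff.2 fun ε hε x => ?_)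
  obtain ⟨n, hn⟩ := exists_nat_one_div_lt (show 0 < ε / 3 by positivity)
  refine ⟨_, UniformSpace.ball_mem_nhds x (hU (B n)), ?_⟩
  filter_upwards [Metric.tendsto_nhds.1 (hg x) (ε / 3) (by positivity)] with k hk y hy
  have h1 := hgm n x y hy
  have h2 := hF k n x y hy
  rw [dist_comm] at h1 hk
  have h4 := dist_triangle4 (g y) (g x) (F k x) (F k y)
  change dist (g y) (F k y) < ε
  linarith

/-- Each coordinate is a convergent sequence of naturals, hence bounded. -/
theorem exists_forall_le_of_tendsto {A : ℕ → ℕ → ℕ → ℕ} {a : ℕ → ℕ → ℕ}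
    (hA : Tendsto A atTop (𝓝 a)) : ∃ B, ∀ k, A k ≤ B := by
  have h : ∀ i j, ∃ b, ∀ k, A k i j ≤ b := fun i j =>
    let ⟨b, hb⟩ := (tendsto_pi_nhds.1 (tendsto_pi_nhds.1 hA i) j).bddAbove_range
    ⟨b, fun k => hb ⟨k, rfl⟩⟩
  choose B hB using h
  exact ⟨B, fun k i j => hB i j k⟩

theorem isSuslin_continuousMap [UniformSpace X] [TopologicalSpace.SeparableSpace X]
    (huc : ∀ f : X → ℝ, Continuous f → UniformContinuous f) {U : (ℕ → ℕ) → Set (X × X)}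
    (hU : (𝓤 X).HasBasis (fun _ => True) U) (hmono : ∀ α β, α ≤ β → U β ⊆ U α) :
    IsSuslin C(X, ℝ) := by
  obtain ⟨D, hDc, hD⟩ := TopologicalSpace.exists_countable_dense X
  have : Countable D := hDc.to_subtype
  have hmem : ∀ α, U α ∈ 𝓤 X := fun α => hU.mem_of_mem trivial
  have hinj : ∀ f g : C(X, ℝ), (∀ d : D, f d = g d) → f = g := fun f g h =>
    ContinuousMap.coe_injective (f.continuous.ext_on hD g.continuous fun x hx => h ⟨x, hx⟩)
  let S : Set ((ℕ → ℕ → ℕ) × (D → ℝ)) :=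
    {p | ∃ f : C(X, ℝ), HasModulus U p.1 f ∧ ∀ d : D, f d = p.2 d}
  have hS : ∀ p, ∃ f : C(X, ℝ), p ∈ S → HasModulus U p.1 f ∧ ∀ d : D, f d = p.2 d := by
    intro p
    by_cases hp : p ∈ S
    · exact ⟨hp.choose, fun _ => hp.choose_spec⟩
    -- The value off `S` is irrelevant: `extendFrom S e` only takes limits within `S`.
    · exact ⟨0, fun h => absurd h hp⟩
  choose e he using hS
  have hseq : ∀ p (u : ℕ → (ℕ → ℕ → ℕ) × (D → ℝ)), Tendsto u atTop (𝓝 p) → (∀ k, u k ∈ S) →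
      ∃ f : C(X, ℝ), (∀ d : D, f d = p.2 d) ∧ Tendsto (fun k => e (u k)) atTop (𝓝 f) := by
    intro p u hu huS
    obtain ⟨B, hB⟩ := exists_forall_le_of_tendsto ((continuous_fst.tendsto p).comp hu)
    refine exists_tendsto_of_hasModulus hmem hD
      (fun k => ((he _ (huS k)).1).mono hmono (hB k)) fun d => ?_
    simp only [fun k => (he _ (huS k)).2 d]
    exact tendsto_pi_nhds.1 ((continuous_snd.tendsto p).comp hu) d
  have hlim : ∀ p ∈ closure S, ∃ f : C(X, ℝ),
      (∀ d : D, f d = p.2 d) ∧ Tendsto e (𝓝[S] p) (𝓝 f) := by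
    intro p hp
    obtain ⟨u, huS, hu⟩ := mem_closure_iff_seq_limit.1 hp
    obtain ⟨f, hf, -⟩ := hseq p u hu huS
    refine ⟨f, hf, tendsto_of_subseq_tendsto fun v hv => ?_⟩
    obtain ⟨hv1, hv2⟩ := tendsto_nhdsWithin_iff.1 hv
    obtain ⟨N, hN⟩ := eventually_atTop.1 hv2
    obtain ⟨g, hg, hvg⟩ := hseq p (fun k => v (k + N)) (hv1.comp (tendsto_add_atTop_nat N))
      fun k => hN _ (Nat.le_add_left N k)
    -- All such limits agree on the dense set `D`, so the limit does not depend on the sequence.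
    rw [hinj f g fun d => (hf d).trans (hg d).symm]
    exact ⟨fun k => k + N, hvg⟩
  have hcont : ContinuousOn (extendFrom S e) (closure S) :=
    continuousOn_extendFrom subset_rfl fun p hp => (hlim p hp).imp fun _ h => h.2
  have : PolishSpace (closure S) := isClosed_closure.polishSpace
  refine isSuslin_of_polishSpace hcont.domRestrict fun f => ?_
  obtain ⟨A, hA⟩ := exists_hasModulus hU (huc f f.continuous)
  have hpS : ((A, fun d : D => f d) : (ℕ → ℕ → ℕ) × (D → ℝ)) ∈ S := ⟨f, hA, fun _ => rfl⟩
  refine ⟨⟨_, subset_closure hpS⟩, ?_⟩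
  obtain ⟨g, hg, hlimg⟩ := hlim _ (subset_closure hpS)
  exact (extendFrom_eq (subset_closure hpS) hlimg).trans (hinj g f hg)

end FunctionSpaceSuslin

/-! ### Spaces whose function space is Suslin -/

section SuslinFunctionSpace

variable {X : Type u} [TopologicalSpace X]

theorem IsSuslin.exists_continuous_surjective {Y : Type u} [TopologicalSpace Y] [Nonempty Y]
    (h : IsSuslin Y) : ∃ F : (ℕ → ℕ) → Y, Continuous F ∧ Function.Surjective F := by
  obtain ⟨P, _, _, f, hf, hs⟩ := h
  have h := MeasureTheory.analyticSet_range_of_polishSpace hf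
  rw [hs.range_eq, MeasureTheory.AnalyticSet] at h
  obtain h | ⟨F, hF, hr⟩ := h
  · exact absurd h Set.univ_nonempty.ne_empty
  · exact ⟨F, hF, Set.range_eq_univ.1 hr⟩

theorem exists_continuousMap_eq_zero_lt_one_imp_mem [CompletelyRegularSpace X] {x : X} {s : Set X}
    (hs : s ∈ 𝓝 x) : ∃ f : C(X, ℝ), f x = 0 ∧ ∀ y, f y < 1 → y ∈ s := by
  obtain ⟨V, hVs, hV, hxV⟩ := mem_nhds_iff.1 hs
  obtain ⟨f, hf, hfx, hf1⟩ := CompletelyRegularSpace.completely_regular x Vᶜ hV.isClosed_compl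
    (fun h => h hxV)
  refine ⟨⟨fun y => f y, by fun_prop⟩, by simp [hfx], fun y hy => hVs ?_⟩
  by_contra hyV
  have : f y = 1 := hf1 hyV
  simp [this] at hy

theorem separableSpace_of_continuous_surjective [CompletelyRegularSpace X] {P : Type*}
    [TopologicalSpace P] [SecondCountableTopology P] {F : P → C(X, ℝ)} (hF : Continuous F)
    (hs : Function.Surjective F) : TopologicalSpace.SeparableSpace X := by
  -- If `F p` vanishes at `x` and is at least 1 off `s`, a small basic `b` around `p` has `x ∈ N b ⊆
  -- s`; one point from each nonempty `N b` suffices.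
  let N : Set P → Set X := fun b => {x | ∀ p ∈ b, F p x < 1}
  let 𝒩 : Set (Set P) := {b ∈ TopologicalSpace.countableBasis P | (N b).Nonempty}
  have h𝒩 : 𝒩.Countable := (TopologicalSpace.countable_countableBasis P).mono fun _ h => h.1
  have : Countable 𝒩 := h𝒩.to_subtype
  refine ⟨Set.range fun b : 𝒩 => b.2.2.some, Set.countable_range _, fun x => ?_⟩
  refine mem_closure_iff_nhds.2 fun s hsx => ?_
  obtain ⟨f, hfx, hf⟩ := exists_continuousMap_eq_zero_lt_one_imp_mem hsx
  obtain ⟨p, rfl⟩ := hs f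
  have hev : {q | F q x < 1} ∈ 𝓝 p :=
    ((continuous_eval_const x).comp hF).continuousAt.eventually_lt_const (by simp [hfx])
  obtain ⟨b, hb, hpb, hbs⟩ := (TopologicalSpace.isBasis_countableBasis P).mem_nhds_iff.1 hev
  have hb' : b ∈ 𝒩 := ⟨hb, x, fun q hq => hbs hq⟩
  exact ⟨_, hf _ (hb'.2.some_mem p hpb), ⟨b, hb'⟩, rfl⟩

/-- Compact sets of functions on an Ascoli space are equicontinuous. -/
theorem IsAscoli.eventually_dist_le (hX : IsAscoli X) {K : Set C(X, ℝ)} (hK : IsCompact K) (x : X)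
    {ε : ℝ} (hε : 0 < ε) : ∀ᶠ y in 𝓝 x, ∀ f ∈ K, dist (f x) (f y) ≤ ε := by
  have h := ContinuousMap.tendsto_iff_forall_isCompact_tendstoUniformlyOn.1 (hX.tendsto x) K hK
  filter_upwards [Metric.tendstoUniformlyOn_iff.1 h ε hε] with y hy f hf
  exact (hy f hf).le

/-- The pairs of points on which all functions `F β` with `β ≤ α` differ by at most
`1 / (α 0 + 1)`. -/
def boxEntourage (F : (ℕ → ℕ) → C(X, ℝ)) (α : ℕ → ℕ) : Set (X × X) :=
  {p | ∀ β ≤ α, dist (F β p.1) (F β p.2) ≤ 1 / ((α 0 : ℝ) + 1)}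

theorem boxEntourage_anti (F : (ℕ → ℕ) → C(X, ℝ)) : Antitone (boxEntourage F) :=
  fun α α' h _ hp β hβ => (hp β (hβ.trans h)).trans
    (one_div_le_one_div_of_le (by positivity) (by gcongr; exact h 0))

theorem hasBasis_iInf_boxEntourage (F : (ℕ → ℕ) → C(X, ℝ)) :
    (⨅ α, 𝓟 (boxEntourage F α)).HasBasis (fun _ => True) (boxEntourage F) :=
  hasBasis_iInf_principal (boxEntourage_anti F).directed_ge

theorem exists_boxEntourage_dist_lt (F : (ℕ → ℕ) → C(X, ℝ)) (β : ℕ → ℕ) {ε : ℝ} (hε : 0 < ε) :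
    ∃ α, ∀ p ∈ boxEntourage F α, dist (F β p.1) (F β p.2) < ε := by
  obtain ⟨n, hn⟩ := exists_nat_one_div_lt hε
  -- This index puts `β` in the box and makes coordinate 0 at least `n`, which sets the tolerance.
  refine ⟨β ⊔ fun _ => n, fun p hp => (hp β le_sup_left).trans_lt (lt_of_le_of_lt ?_ hn)⟩
  refine one_div_le_one_div_of_le (by positivity) ?_
  have : n ≤ (β ⊔ fun _ => n) 0 := le_sup_right (a := β 0)
  gcongr

/-- The uniformity generated by the sets `boxEntourage F α`, as a filter with its axioms. -/
def boxUniformityCore (F : (ℕ → ℕ) → C(X, ℝ)) : UniformSpace.Core X where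
  uniformity := ⨅ α, 𝓟 (boxEntourage F α)
  refl := by
    refine (hasBasis_iInf_boxEntourage F).ge_iff.2 fun α _ => ?_
    rintro ⟨x, y⟩ (rfl : x = y) β _
    simp only [dist_self]
    positivity
  symm := (hasBasis_iInf_boxEntourage F).tendsto_iff (hasBasis_iInf_boxEntourage F) |>.2
    fun α _ => ⟨α, trivial, fun p hp β hβ => by rw [dist_comm]; exact hp β hβ⟩
  comp := by
    refine (hasBasis_iInf_boxEntourage F).ge_iff.2 fun α _ => ?_
    -- The box grows, and `γ 0 + 1 = 2 * (α 0 + 1)` halves the tolerance.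
    let γ : ℕ → ℕ := fun i => 2 * α i + 1
    refine (mem_lift'_sets (monotone_id.relComp monotone_id)).2
      ⟨boxEntourage F γ, (hasBasis_iInf_boxEntourage F).mem_of_mem trivial, ?_⟩
    rintro ⟨x, z⟩ ⟨y, hxy, hyz⟩ β hβ
    have hβγ : β ≤ γ := hβ.trans fun i => by simp only [γ]; omega
    have h1 := hxy β hβγ
    have h2 := hyz β hβγ
    have h3 := dist_triangle (F β x) (F β y) (F β z)
    have h4 : 1 / ((γ 0 : ℝ) + 1) + 1 / ((γ 0 : ℝ) + 1) = 1 / ((α 0 : ℝ) + 1) := by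
      simp only [γ]
      push_cast
      field_simp
      ring
    simp only at h1 h2 ⊢
    linarith

/-- Equicontinuity on compact boxes gives `≤`; for `≥`, a function separating `x` from the
complement of a neighbourhood is some `F β`. -/
theorem nhds_eq_comap_boxUniformityCore [CompletelyRegularSpace X] (hX : IsAscoli X)
    {F : (ℕ → ℕ) → C(X, ℝ)} (hF : Continuous F) (hs : Function.Surjective F) (x : X) :
    𝓝 x = comap (Prod.mk x) (boxUniformityCore F).uniformity := by
  have hbasis := (hasBasis_iInf_boxEntourage F).comap (Prod.mk x)
  refine le_antisymm (hbasis.ge_iff.2 fun α _ => ?_) fun s hsx => hbasis.mem_iff.2 ?_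
  · have hK : IsCompact (F '' Set.Iic α) := by
      rw [← Set.Icc_bot]
      exact isCompact_Icc.image hF
    filter_upwards [hX.eventually_dist_le hK x (ε := 1 / ((α 0 : ℝ) + 1)) (by positivity)]
      with y hy β hβ
    exact hy _ ⟨β, hβ, rfl⟩
  · obtain ⟨f, hfx, hf⟩ := exists_continuousMap_eq_zero_lt_one_imp_mem hsx
    obtain ⟨β, rfl⟩ := hs f
    obtain ⟨α, hα⟩ := exists_boxEntourage_dist_lt F β one_pos
    refine ⟨α, trivial, fun y hy => hf y ?_⟩
    have h : dist (F β x) (F β y) < 1 := hα (x, y) hy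
    rw [hfx, dist_zero_left, Real.norm_eq_abs] at h
    exact (le_abs_self _).trans_lt h

theorem exists_isRealUniversal_isOmegaOmegaBased [CompletelyRegularSpace X] (hX : IsAscoli X)
    {F : (ℕ → ℕ) → C(X, ℝ)} (hF : Continuous F) (hs : Function.Surjective F) :
    ∃ 𝒰 : UniformSpace X, IsRealUniversal 𝒰 ∧ IsOmegaOmegaBased 𝒰 := by
  refine ⟨{ uniformity := (boxUniformityCore F).uniformity
            symm := (boxUniformityCore F).symm
            comp := (boxUniformityCore F).comp
            nhds_eq_comap_uniformity := nhds_eq_comap_boxUniformityCore hX hF hs },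
    ⟨rfl, fun f hf => ?_⟩, boxEntourage F, hasBasis_iInf_boxEntourage F, boxEntourage_anti F⟩
  obtain ⟨β, hβ⟩ := hs ⟨f, hf⟩
  refine ((hasBasis_iInf_boxEntourage F).tendsto_iff Metric.uniformity_basis_dist).2 fun ε hε => ?_
  obtain ⟨α, hα⟩ := exists_boxEntourage_dist_lt F β hε
  refine ⟨α, trivial, fun p hp => ?_⟩
  have h := hα p hp
  rwa [hβ] at h

end SuslinFunctionSpace

theorem theorem1p5 {X : Type u} [TopologicalSpace X] [T35Space X] :
    (TopologicalSpace.SeparableSpace X →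
      (∃ 𝒰 : UniformSpace X, IsRealUniversal 𝒰 ∧ IsOmegaOmegaBased 𝒰) →
        IsSuslin C(X, ℝ)) ∧
    (IsAscoli X → IsSuslin C(X, ℝ) →
      TopologicalSpace.SeparableSpace X ∧
        ∃ 𝒰 : UniformSpace X, IsRealUniversal 𝒰 ∧ IsOmegaOmegaBased 𝒰) := by
  refine ⟨?_, fun hX hC => ?_⟩
  · rintro hsep ⟨𝒰, ⟨rfl, huc⟩, U, hU, hmono⟩
    exact isSuslin_continuousMap huc hU hmono
  · obtain ⟨F, hF, hs⟩ := hC.exists_continuous_surjective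
    exact ⟨separableSpace_of_continuous_surjective hF hs,
      exists_isRealUniversal_isOmegaOmegaBased hX hF hs⟩
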